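/- Let $n\ge 1$ be an odd integer, put $\hat n=\frac{n-1}{2}$, and for $h>0$ let $$L_n(f)=h\sum_{k=-\hat n}^{\hat n}w_k\,f(kh),\qquad w_k=\int_{-1/2}^{1/2}\ \prod_{\substack{i=-\hat n\\ i\ne k}}^{\hat n}\frac{u-i}{k-i}\,du ,$$ be the simple $n$-point rule, i.e. the integral over $[-h/2,h/2]$ of the polynomial of degree at most $n-1$ that interpolates $f$ at the points $kh$, $k=-\hat n,\dots,\hat n$. Let $$R_n(f)=L_n(f)-\int_{-h/2}^{h/2}f(x)\,dx$$ be its error, and let $I_{n,h}=[-rh,rh]$ with $r=\max(\hat n,\tfrac12)$ be the smallest interval containing the points $kh$ and the interval $[-h/2,h/2]$. Then: 1. The number $\hat R_n=R_n\!\left(\frac{x^{n+1}}{(n+1)!}\right)/h^{n+2}$ does not depend on $h>0$; it depends only on $n$. 2. For every $h>0$ and every real function $f$ that is $n+1$ times differentiable on $I_{n,h}$ (one-sided derivatives at the endpoints, and $f^{(n+1)}$ not assumed continuous), there is a $\xi\in I_{n,h}$ such that $$R_n(f)=f^{(n+1)}(\xi)\,R_n\!\left(\frac{x^{n+1}}{(n+1)!}\right)=\hat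 R_n\,h^{n+2}f^{(n+1)}(\xi).$$ 3. The $n$-point rule is of order $n$: for every $h>0$ and every real polynomial $p$ of degree at most $n$, $R_n(p)=0$. -/

import Mathlib

noncomputable section

namespace CenteredRule

/-- `n̂ = (n - 1) / 2`; the number of points `n` is odd throughout. -/
def nhat (n : ℕ) : ℕ := (n - 1) / 2

/-- The index set `{-n̂, …, n̂}`. -/
def indices (n : ℕ) : Finset ℤ := Finset.Icc (-(nhat n : ℤ)) (nhat n : ℤ)

/-- The Lagrange basis polynomial attached to the node `k h`, for the nodes `i h`, `|i| ≤ n̂`. -/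
def lagrangeBasis (n : ℕ) (h : ℝ) (k : ℤ) (x : ℝ) : ℝ :=
  ∏ i ∈ (indices n).erase k, (x - i * h) / ((k - i) * h)

/-- The polynomial of degree at most `n - 1` that interpolates `f` at the nodes `k h`. -/
def interpolant (n : ℕ) (h : ℝ) (f : ℝ → ℝ) (x : ℝ) : ℝ :=
  ∑ k ∈ indices n, lagrangeBasis n h k x * f (k * h)

/-- The normalized weights of the rule. -/
def weight (n : ℕ) (k : ℤ) : ℝ :=
  ∫ u in (-1 / 2 : ℝ)..(1 / 2), ∏ i ∈ (indices n).erase k, (u - i) / ((k : ℝ) - i)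

/-- The simple `n`-point rule `L_n`, which approximates the integral over `[-h/2, h/2]`. -/
def simpleRule (n : ℕ) (h : ℝ) (f : ℝ → ℝ) : ℝ :=
  h * ∑ k ∈ indices n, weight n k * f (k * h)

/-- The rule is the integral over `[-h/2, h/2]` of the interpolating polynomial. -/
theorem simpleRule_eq_integral (n : ℕ) {h : ℝ} (hh : 0 < h) (f : ℝ → ℝ) :
    simpleRule n h f = ∫ x in (-h / 2)..(h / 2), interpolant n h f x := by
  have hne : h ≠ 0 := hh.ne'
  unfold interpolant
  rw [intervalIntegral.integral_finsetSum]
  · unfold simpleRule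
    rw [Finset.mul_sum]
    refine Finset.sum_congr rfl fun k _ => ?_
    rw [intervalIntegral.integral_mul_const, ← mul_assoc]
    congr 1
    have key := intervalIntegral.mul_integral_comp_mul_right
      (a := (-1 / 2 : ℝ)) (b := 1 / 2) (f := fun x => lagrangeBasis n h k x) h
    have e1 : (-1 / 2 : ℝ) * h = -h / 2 := by ring
    have e2 : (1 / 2 : ℝ) * h = h / 2 := by ring
    rw [e1, e2] at key
    rw [← key]
    unfold weight
    congr 2
    funext u
    unfold lagrangeBasis
    refine Finset.prod_congr rfl fun i _ => ?_
    rw [← sub_mul, mul_div_mul_right _ _ hne]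
  · intro k _
    apply Continuous.intervalIntegrable
    unfold lagrangeBasis
    fun_prop

/-- The error `R_n(f)`: the value of the rule minus the exact integral. -/
def error (n : ℕ) (h : ℝ) (f : ℝ → ℝ) : ℝ :=
  simpleRule n h f - ∫ x in (-h / 2)..(h / 2), f x

/-- The error of the rule on the monomial `x ^ (n + 1) / (n + 1)!`. -/
def monomialError (n : ℕ) (h : ℝ) : ℝ :=
  error n h fun x => x ^ (n + 1) / (Nat.factorial (n + 1) : ℝ)

/-- The normalized integration error, computed with the step `h`. -/
def normalizedError (n : ℕ) (h : ℝ) : ℝ := monomialError n h / h ^ (n + 2)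

/-- The smallest interval that contains the nodes and the integration interval `[-h/2, h/2]`. It is
`[-h/2, h/2]` if `n = 1` and `[-n̂ h, n̂ h]` if `n ≥ 3`. -/
def hull (n : ℕ) (h : ℝ) : Set ℝ :=
  Set.Icc (-(max (nhat n : ℝ) (1 / 2) * h)) (max (nhat n : ℝ) (1 / 2) * h)

/-- `f` is `m` times differentiable on `s` (the `m`-th derivative need not be continuous). -/
def TimesDifferentiableOn (m : ℕ) (f : ℝ → ℝ) (s : Set ℝ) : Prop :=
  ∀ j < m, DifferentiableOn ℝ (iteratedDerivWithin j f s) s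

/-- The simple `n`-point rule is of order `d`: it integrates polynomials of degree up to `d`
exactly, whatever the step. -/
def HasOrder (n d : ℕ) : Prop :=
  ∀ h : ℝ, 0 < h → ∀ p : Polynomial ℝ, p.natDegree ≤ d → error n h (fun x => p.eval x) = 0

end CenteredRule

end

/-!
The error of the centered `n`-point rule, `n` odd, is handled by Hermite interpolation with the
central node counted twice.

Let `N = ∏ (X - k h)` be the node polynomial. As the nodes are symmetric and odd in number, `N` is
an odd function, so adding a multiple of `N` to the interpolating polynomial does not change its
integral over `[-h/2, h/2]`. Choose the multiple so that the sum `H`, of degree at most `n`, also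
has the derivative of `f` at `0` (`exists_hermite`). Then `R_n(f) = -∫ (f - H)`.

Rolle's theorem, applied `n + 1` times to `f - H - l x N(x)`, which vanishes at a given `x`, at all
nodes and doubly at `0`, gives `f(x) - H(x) = f⁽ⁿ⁺¹⁾(ξ) x N(x) / (n + 1)!` (`hermite_remainder`).
The factor `x N(x)` has a constant sign on `[-h/2, h/2]` (`mul_nodeSign`, `prod_nodes_pos`), and
the values of the derivative `f⁽ⁿ⁺¹⁾` form an interval by Darboux's theorem. Hence a mean value
theorem for integrals, needing neither continuity nor measurability of the mean values
(`exists_integral_eq_mul`), gives `R_n(f) = f⁽ⁿ⁺¹⁾(ξ) K` with `K` independent of `f`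
(`DerivSeq.exists_error_eq`). The function `xⁿ⁺¹ / (n + 1)!` identifies `K`, and polynomials of
degree at most `n` have error `0` because their derivative of order `n + 1` vanishes.
-/

namespace CenteredRule

open Polynomial Set

/-! ### Sequences of successive derivatives -/

/-- `F 0, F 1, …, F m` are successive derivatives on `s`, relative to `s`. Unlike
`iteratedDerivWithin`, whose additivity in Mathlib asks for continuous differentiability, this
notion is stable under differences without further hypotheses. -/
def DerivSeq (m : ℕ) (F : ℕ → ℝ → ℝ) (s : Set ℝ) : Prop :=
  ∀ j < m, ∀ x ∈ s, HasDerivWithinAt (F j) (F (j + 1) x) s x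

theorem TimesDifferentiableOn.derivSeq {m : ℕ} {f : ℝ → ℝ} {s : Set ℝ}
    (hf : TimesDifferentiableOn m f s) : DerivSeq m (fun j => iteratedDerivWithin j f s) s := by
  intro j hj x hx
  have := (hf j hj x hx).hasDerivWithinAt
  rwa [← iteratedDerivWithin_succ] at this

theorem derivSeq_polynomial (m : ℕ) (p : ℝ[X]) (s : Set ℝ) :
    DerivSeq m (fun j x => (derivative^[j] p).eval x) s := by
  intro j _ x _
  simp only [Function.iterate_succ_apply']
  exact (Polynomial.hasDerivAt _ x).hasDerivWithinAt

theorem DerivSeq.sub {m : ℕ} {F G : ℕ → ℝ → ℝ} {s : Set ℝ} (hF : DerivSeq m F s)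
    (hG : DerivSeq m G s) : DerivSeq m (fun j x => F j x - G j x) s :=
  fun j hj x hx => (hF j hj x hx).sub (hG j hj x hx)

theorem DerivSeq.tail {m : ℕ} {F : ℕ → ℝ → ℝ} {s : Set ℝ} (hF : DerivSeq (m + 1) F s) :
    DerivSeq m (fun j => F (j + 1)) s :=
  fun j hj => hF (j + 1) (by omega)

/-! ### Zeros of derivatives -/

/-- Rolle's theorem between consecutive zeros: the new zeros are distinct from the old ones, which
allows a double zero to be counted in addition. -/
theorem exists_finset_deriv_zeros {a b : ℝ} {g g' : ℝ → ℝ}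
    (hg : ∀ x ∈ Icc a b, HasDerivWithinAt g (g' x) (Icc a b) x) (S : Finset ℝ)
    (hS : ∀ x ∈ S, x ∈ Icc a b ∧ g x = 0) :
    ∃ T : Finset ℝ, (∀ x ∈ T, x ∈ Icc a b ∧ g' x = 0) ∧ Disjoint T S ∧ S.card ≤ T.card + 1 := by
  have rolle : ∀ x y : ℝ, ∃ z, x ∈ S → y ∈ S → x < y → z ∈ Ioo x y ∧ z ∈ Icc a b ∧ g' z = 0 := by
    intro x y
    by_cases h : x ∈ S ∧ y ∈ S ∧ x < y
    · obtain ⟨hx, hy, hxy⟩ := h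
      have hsub : Icc x y ⊆ Icc a b := Icc_subset_Icc (hS x hx).1.1 (hS y hy).1.2
      obtain ⟨z, hz, hz0⟩ := exists_hasDerivAt_eq_zero (f := g) (f' := g') hxy
        (fun t ht => ((hg t (hsub ht)).continuousWithinAt).mono hsub)
        ((hS x hx).2.trans (hS y hy).2.symm)
        (fun t ht => (hg t (hsub (Ioo_subset_Icc_self ht))).hasDerivAt
          (Filter.mem_of_superset (Icc_mem_nhds ht.1 ht.2) hsub))
      exact ⟨z, fun _ _ _ => ⟨hz, hsub (Ioo_subset_Icc_self hz), hz0⟩⟩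
    · exact ⟨0, fun hx hy hxy => absurd ⟨hx, hy, hxy⟩ h⟩
  choose z hz using rolle
  let Z : Finset ℝ := ((S ×ˢ S).filter fun p => p.1 < p.2).image fun p => z p.1 p.2
  refine ⟨Z \ S, ?_, Finset.sdiff_disjoint, ?_⟩
  · intro t ht
    simp only [Z, Finset.mem_sdiff, Finset.mem_image, Finset.mem_filter, Finset.mem_product,
      Prod.exists] at ht
    obtain ⟨⟨x, y, ⟨⟨hx, hy⟩, hxy⟩, rfl⟩, -⟩ := ht
    exact (hz x y hx hy hxy).2
  · refine Finset.card_le_sdiff_of_interleaved fun x hx y hy hxy _ => ⟨z x y, ?_, ?_⟩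
    · exact Finset.mem_image.2 ⟨(x, y), by simp [hx, hy, hxy], rfl⟩
    · exact (hz x y hx hy hxy).1

theorem DerivSeq.exists_zero {a b : ℝ} {m : ℕ} {F : ℕ → ℝ → ℝ} (hF : DerivSeq m F (Icc a b))
    (S : Finset ℝ) (hS : ∀ x ∈ S, x ∈ Icc a b ∧ F 0 x = 0) (hcard : m < S.card) :
    ∃ ξ ∈ Icc a b, F m ξ = 0 := by
  induction m generalizing F S with
  | zero =>
    obtain ⟨x, hx⟩ := Finset.card_pos.1 hcard
    exact ⟨x, hS x hx⟩
  | succ m ih =>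
    obtain ⟨T, hT, -, hc⟩ := exists_finset_deriv_zeros (hF 0 m.succ_pos) S hS
    exact ih hF.tail T hT (by omega)

/-- Iterated Rolle with a double zero at `c`: the zero of `F 1` at `c` is not among those that
Rolle's theorem places strictly between the zeros of `F 0`. -/
theorem DerivSeq.exists_zero_of_double {a b : ℝ} {m : ℕ} {F : ℕ → ℝ → ℝ}
    (hF : DerivSeq (m + 1) F (Icc a b)) (S : Finset ℝ)
    (hS : ∀ x ∈ S, x ∈ Icc a b ∧ F 0 x = 0) (hcard : m < S.card) {c : ℝ} (hc : c ∈ S)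
    (hc' : F 1 c = 0) : ∃ ξ ∈ Icc a b, F (m + 1) ξ = 0 := by
  obtain ⟨T, hT, hdisj, hle⟩ := exists_finset_deriv_zeros (hF 0 m.succ_pos) S hS
  have hcT : c ∉ T := fun h => Finset.disjoint_left.1 hdisj h hc
  refine hF.tail.exists_zero (insert c T) ?_ ?_
  · intro x hx
    rcases Finset.mem_insert.1 hx with rfl | hx
    · exact ⟨(hS _ hc).1, hc'⟩
    · exact hT x hx
  · rw [Finset.card_insert_of_notMem hcT]
    omega

/-! ### Hermite interpolation with one double node -/

theorem iterate_derivative_eq_C {d : ℕ} {p : ℝ[X]} (hp : p.natDegree ≤ d) :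
    derivative^[d] p = C ((d.factorial : ℝ) * p.coeff d) := by
  ext k
  rw [coeff_iterate_derivative, coeff_C]
  split_ifs with hk
  · subst hk
    simp [Nat.descFactorial_self]
  · rw [coeff_eq_zero_of_natDegree_lt (by omega), smul_zero]

/-- The remainder of Hermite interpolation at the nodes `v i`, with `v i₀` counted twice. -/
theorem hermite_remainder {ι : Type*} [DecidableEq ι] {a b : ℝ} {s : Finset ι} {v : ι → ℝ}
    (hv : InjOn v s) (hvI : ∀ i ∈ s, v i ∈ Icc a b) {i₀ : ι} (hi₀ : i₀ ∈ s)
    {F : ℕ → ℝ → ℝ} (hF : DerivSeq (s.card + 1) F (Icc a b)) {H : ℝ[X]}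
    (hdeg : H.natDegree ≤ s.card) (hH : ∀ i ∈ s, H.eval (v i) = F 0 (v i))
    (hH' : (derivative H).eval (v i₀) = F 1 (v i₀)) {x : ℝ} (hx : x ∈ Icc a b) :
    ∃ ξ ∈ Icc a b, F 0 x - H.eval x = F (s.card + 1) ξ *
      ((x - v i₀) * (Lagrange.nodal s v).eval x / ((s.card + 1).factorial : ℝ)) := by
  by_cases hnode : ∃ i ∈ s, x = v i
  · obtain ⟨i, hi, rfl⟩ := hnode
    exact ⟨v i, hx, by simp [Lagrange.eval_nodal_at_node hi, hH i hi]⟩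
  push Not at hnode
  set N := Lagrange.nodal s v with hN
  have hw : (x - v i₀) * N.eval x ≠ 0 :=
    mul_ne_zero (sub_ne_zero.2 (hnode i₀ hi₀)) (Lagrange.eval_nodal_not_at_node hnode)
  -- With this `l`, the polynomial `H + l M` below also agrees with `F 0` at `x`.
  set l : ℝ := (F 0 x - H.eval x) / ((x - v i₀) * N.eval x) with hl
  set M : ℝ[X] := (X - C (v i₀)) * N with hM
  have hMmonic : M.Monic := (monic_X_sub_C _).mul Lagrange.nodal_monic
  have hMdeg : M.natDegree = s.card + 1 := by
    rw [hM, (monic_X_sub_C _).natDegree_mul Lagrange.nodal_monic, natDegree_X_sub_C,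
      Lagrange.natDegree_nodal, add_comm]
  have hMnode : ∀ i ∈ s, M.eval (v i) = 0 := fun i hi => by
    simp [hM, hN, Lagrange.eval_nodal_at_node hi]
  have hM' : (derivative M).eval (v i₀) = 0 := by
    simp [hM, hN, Lagrange.eval_nodal_at_node hi₀]
  have hQdeg : (H + C l * M).natDegree ≤ s.card + 1 :=
    (natDegree_add_le _ _).trans (max_le (by omega) ((natDegree_C_mul_le _ _).trans hMdeg.le))
  have hQcoeff : (H + C l * M).coeff (s.card + 1) = l := by
    rw [coeff_add, coeff_eq_zero_of_natDegree_lt (by omega : H.natDegree < s.card + 1), coeff_C_mul,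
      ← hMdeg, hMmonic.coeff_natDegree]
    ring
  have hxS : x ∉ s.image v := fun h => by
    obtain ⟨i, hi, h⟩ := Finset.mem_image.1 h
    exact hnode i hi h.symm
  obtain ⟨ξ, hξ, h0⟩ := (hF.sub (derivSeq_polynomial _ (H + C l * M) _)).exists_zero_of_double
    (insert x (s.image v)) (c := v i₀) (by
      intro t ht
      rcases Finset.mem_insert.1 ht with rfl | ht
      · refine ⟨hx, ?_⟩
        have : M.eval t = (t - v i₀) * N.eval t := by simp [hM]
        simp only [Function.iterate_zero, id, eval_add, eval_mul, eval_C, this, hl,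
          div_mul_cancel₀ _ hw]
        ring
      · obtain ⟨i, hi, rfl⟩ := Finset.mem_image.1 ht
        exact ⟨hvI i hi, by simp [hMnode i hi, hH i hi]⟩)
    (by rw [Finset.card_insert_of_notMem hxS, Finset.card_image_of_injOn hv]; omega)
    (Finset.mem_insert_of_mem (Finset.mem_image_of_mem _ hi₀))
    (by simp [hM', hH'])
  refine ⟨ξ, hξ, ?_⟩
  rw [iterate_derivative_eq_C hQdeg, hQcoeff, eval_C, sub_eq_zero] at h0
  have hfac : ((s.card + 1).factorial : ℝ) ≠ 0 := by positivity
  rw [h0, mul_div_assoc', mul_assoc, mul_div_cancel_left₀ _ hfac, hl, div_mul_cancel₀ _ hw]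

/-! ### A mean value theorem for integrals -/

/-- A mean value theorem for integrals in which the mean values `d` are only known to lie,
pointwise, in an interval `D`. The weight `w` has the sign of `σ`. -/
theorem exists_integral_eq_mul {a b : ℝ} (hab : a < b) {g w : ℝ → ℝ}
    (hg : ContinuousOn g (Icc a b)) (hw : ContinuousOn w (Icc a b)) {σ : ℝ}
    (hσ : ∀ x ∈ Icc a b, 0 ≤ w x * σ) (hpos : ∃ x ∈ Icc a b, 0 < w x * σ) {D : Set ℝ}
    (hD : D.OrdConnected) (hgw : ∀ x ∈ Icc a b, ∃ d ∈ D, g x = d * w x) :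
    ∃ d ∈ D, ∫ x in a..b, g x = d * ∫ x in a..b, w x := by
  obtain ⟨x₀, hx₀, hx₀pos⟩ := hpos
  have hσ0 : σ ≠ 0 := by rintro rfl; simp at hx₀pos
  have hgi : IntervalIntegrable g MeasureTheory.volume a b :=
    hg.intervalIntegrable_of_Icc hab.le
  have hwi : IntervalIntegrable w MeasureTheory.volume a b :=
    hw.intervalIntegrable_of_Icc hab.le
  have hwpos : 0 < ∫ x in a..b, w x * σ :=
    intervalIntegral.integral_pos hab (hw.mul continuousOn_const)
      (fun x hx => hσ x (Ioc_subset_Icc_self hx)) ⟨x₀, hx₀, hx₀pos⟩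
  rw [intervalIntegral.integral_mul_const] at hwpos
  have hw0 : ∫ x in a..b, w x ≠ 0 := by rintro h; simp [h] at hwpos
  set c := (∫ x in a..b, g x) / ∫ x in a..b, w x with hc
  have hcw : ∫ x in a..b, g x = c * ∫ x in a..b, w x := by rw [hc]; field_simp
  refine ⟨c, ?_, hcw⟩
  have key : ∀ τ : ℝ, ∫ x in a..b, (g x - c * w x) * (σ * τ) = 0 := by
    intro τ
    rw [intervalIntegral.integral_mul_const, intervalIntegral.integral_sub hgi (hwi.const_mul c),
      intervalIntegral.integral_const_mul, hcw]
    ring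
  -- If `c ∉ D`, then `d - c` has a constant sign `τ` for `d ∈ D`.
  have contra : ∀ τ : ℝ, ¬ ∀ d ∈ D, 0 < (d - c) * τ := by
    intro τ hτ
    have := intervalIntegral.integral_pos (f := fun x => (g x - c * w x) * (σ * τ)) hab
      ((hg.sub (continuousOn_const.mul hw)).mul continuousOn_const)
      (fun x hx => by
        obtain ⟨d, hd, h⟩ := hgw x (Ioc_subset_Icc_self hx)
        have := mul_nonneg (hτ d hd).le (hσ x (Ioc_subset_Icc_self hx))
        rw [h]; linarith)
      ⟨x₀, hx₀, by
        obtain ⟨d, hd, h⟩ := hgw x₀ hx₀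
        have := mul_pos (hτ d hd) hx₀pos
        simp only [h]; linarith⟩
    exact this.ne' (key τ)
  by_contra hcD
  by_cases hlt : ∃ d ∈ D, d < c
  · obtain ⟨d, hd, hdc⟩ := hlt
    refine contra (-1) fun e he => ?_
    have : e < c := by
      by_contra hce
      exact hcD (hD.out hd he ⟨hdc.le, not_lt.1 hce⟩)
    linarith
  · push Not at hlt
    refine contra 1 fun e he => ?_
    have : c < e := lt_of_le_of_ne (hlt e he) fun h => hcD (h ▸ he)
    linarith

/-! ### The nodes and the node polynomial -/

variable {n : ℕ} {h : ℝ}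

theorem card_indices (hn : Odd n) : (indices n).card = n := by
  obtain ⟨m, rfl⟩ := hn
  simp [indices, nhat]
  omega

theorem zero_mem_indices (n : ℕ) : (0 : ℤ) ∈ indices n := by simp [indices]

theorem neg_mem_indices {k : ℤ} : -k ∈ indices n ↔ k ∈ indices n := by
  simp only [indices, Finset.mem_Icc]; omega

theorem node_injective (hh : 0 < h) : Function.Injective fun k : ℤ => (k : ℝ) * h := by
  intro i j hij
  exact_mod_cast mul_right_cancel₀ hh.ne' hij

theorem node_mem_hull (hh : 0 < h) {k : ℤ} (hk : k ∈ indices n) : (k : ℝ) * h ∈ hull n h := by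
  simp only [indices, Finset.mem_Icc] at hk
  have h1 : (-(nhat n : ℝ)) ≤ k := by exact_mod_cast hk.1
  have h2 : (k : ℝ) ≤ nhat n := by exact_mod_cast hk.2
  have h3 := le_max_left (nhat n : ℝ) (1 / 2)
  rw [hull, mem_Icc, ← neg_mul]
  constructor <;> gcongr <;> linarith

theorem Icc_subset_hull (hh : 0 < h) : Icc (-h / 2) (h / 2) ⊆ hull n h := by
  have h3 := mul_le_mul_of_nonneg_right (le_max_right (nhat n : ℝ) (1 / 2)) hh.le
  exact Icc_subset_Icc (by linarith) (by linarith)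

/-- The node polynomial `∏ (X - k h)`, `|k| ≤ n̂`. -/
noncomputable def nodePoly (n : ℕ) (h : ℝ) : ℝ[X] := Lagrange.nodal (indices n) fun k => (k : ℝ) * h

theorem eval_nodePoly (x : ℝ) : (nodePoly n h).eval x = ∏ k ∈ indices n, (x - k * h) :=
  Lagrange.eval_nodal

theorem eval_nodePoly_neg (hn : Odd n) (x : ℝ) :
    (nodePoly n h).eval (-x) = -(nodePoly n h).eval x := by
  simp only [eval_nodePoly]
  have e : ∏ k ∈ indices n, (-x - k * h) = ∏ k ∈ indices n, (-1) * (x - k * h) := by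
    refine Finset.prod_nbij' Neg.neg Neg.neg ?_ ?_ ?_ ?_ ?_
    · exact fun k hk => neg_mem_indices.2 hk
    · exact fun k hk => neg_mem_indices.2 hk
    · simp
    · simp
    · intro k _; push_cast; ring
  rw [e, Finset.prod_mul_distrib, Finset.prod_const, card_indices hn, hn.neg_one_pow]
  ring

theorem integral_nodePoly (hn : Odd n) : ∫ x in (-h / 2)..(h / 2), (nodePoly n h).eval x = 0 := by
  have e := intervalIntegral.integral_comp_neg (a := -h / 2) (b := h / 2)
    (fun x => (nodePoly n h).eval x)
  simp only [eval_nodePoly_neg hn, intervalIntegral.integral_neg] at e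
  rw [show -(h / 2) = -h / 2 by ring, show -(-h / 2) = h / 2 by ring] at e
  linarith

/-- The product `∏ (-k h)` over the nonzero nodes; its sign is that of `x * ∏ (x - k h)` for
`0 < |x| ≤ h / 2`. -/
noncomputable def nodeSign (n : ℕ) (h : ℝ) : ℝ := ∏ k ∈ (indices n).erase 0, (0 - (k : ℝ) * h)

theorem mul_nodeSign (x : ℝ) : x * (nodePoly n h).eval x * nodeSign n h =
    x ^ 2 * ∏ k ∈ (indices n).erase 0, ((x - k * h) * (0 - k * h)) := by
  rw [eval_nodePoly, ← Finset.mul_prod_erase _ _ (zero_mem_indices n), Finset.prod_mul_distrib,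
    nodeSign]
  push_cast
  ring

theorem prod_nodes_pos (hh : 0 < h) {x : ℝ} (hx : x ∈ Icc (-h / 2) (h / 2)) :
    0 < ∏ k ∈ (indices n).erase 0, ((x - k * h) * (0 - (k : ℝ) * h)) := by
  refine Finset.prod_pos fun k hk => ?_
  obtain ⟨hx1, hx2⟩ := hx
  rcases lt_or_gt_of_ne (Finset.ne_of_mem_erase hk) with hk0 | hk0
  · have : (k : ℝ) ≤ -1 := by exact_mod_cast Int.le_sub_one_of_lt hk0
    exact mul_pos (by nlinarith) (by nlinarith)
  · have : (1 : ℝ) ≤ k := by exact_mod_cast hk0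
    exact mul_pos_of_neg_of_neg (by nlinarith) (by nlinarith)

/-! ### The error of the rule -/

theorem eval_interpolate (f : ℝ → ℝ) (x : ℝ) :
    (Lagrange.interpolate (indices n) (fun k : ℤ => (k : ℝ) * h) fun k => f (k * h)).eval x =
      interpolant n h f x := by
  simp only [Lagrange.interpolate_apply, eval_finsetSum, eval_mul, eval_C, interpolant,
    Lagrange.basis, eval_prod, Lagrange.basisDivisor, eval_sub, eval_X, lagrangeBasis]
  refine Finset.sum_congr rfl fun k _ => ?_
  rw [mul_comm]
  congr 1
  refine Finset.prod_congr rfl fun i _ => ?_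
  rw [sub_mul, div_eq_inv_mul]

/-- The rule integrates exactly a polynomial `H` that interpolates `f` at the nodes and has a
prescribed derivative at `0`. -/
theorem exists_hermite (hn : Odd n) (hh : 0 < h) (f : ℝ → ℝ) (y : ℝ) :
    ∃ H : ℝ[X], H.natDegree ≤ n ∧ (∀ k ∈ indices n, H.eval (k * h) = f (k * h)) ∧
      (derivative H).eval 0 = y ∧
      simpleRule n h f = ∫ x in (-h / 2)..(h / 2), H.eval x := by
  have hinj : InjOn (fun k : ℤ => (k : ℝ) * h) (indices n) := (node_injective hh).injOn
  set P := Lagrange.interpolate (indices n) (fun k : ℤ => (k : ℝ) * h) fun k => f (k * h) with hP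
  have hN' : (derivative (nodePoly n h)).eval 0 ≠ 0 := by
    have := Lagrange.eval_nodal_derivative_eval_node_eq (v := fun k : ℤ => (k : ℝ) * h)
      (zero_mem_indices n)
    simp only [Int.cast_zero, zero_mul] at this
    rw [nodePoly, this, Lagrange.eval_nodal]
    refine Finset.prod_ne_zero_iff.2 fun k hk => ?_
    have : (k : ℝ) ≠ 0 := by exact_mod_cast Finset.ne_of_mem_erase hk
    simp [this, hh.ne']
  set c := (y - (derivative P).eval 0) / (derivative (nodePoly n h)).eval 0 with hc
  refine ⟨P + C c * nodePoly n h, ?_, ?_, ?_, ?_⟩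
  · refine (natDegree_add_le _ _).trans (max_le ?_ ((natDegree_C_mul_le _ _).trans ?_))
    · rw [natDegree_le_iff_degree_le]
      refine (Lagrange.degree_interpolate_lt _ hinj).le.trans ?_
      rw [card_indices hn]
    · rw [nodePoly, Lagrange.natDegree_nodal, card_indices hn]
  · intro k hk
    have h1 := Lagrange.eval_interpolate_at_node (fun k : ℤ => f (k * h)) hinj hk
    have h2 := Lagrange.eval_nodal_at_node (v := fun k : ℤ => (k : ℝ) * h) hk
    rw [← hP] at h1
    rw [eval_add, eval_mul, nodePoly, h1, h2, mul_zero, add_zero]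
  · simp only [derivative_add, derivative_C_mul, eval_add, eval_mul, eval_C, hc]
    field_simp
    ring
  · rw [simpleRule_eq_integral n hh]
    simp only [← eval_interpolate, ← hP, eval_add, eval_mul, eval_C]
    rw [intervalIntegral.integral_add (P.continuous.intervalIntegrable _ _)
      (((nodePoly n h).continuous.intervalIntegrable _ _).const_mul c),
      intervalIntegral.integral_const_mul, integral_nodePoly hn, mul_zero, add_zero]

/-- The factor `-∫ x ∏ (x - k h) / (n + 1)!`, over `[-h/2, h/2]`, of the derivative of order `n + 1`
in the error of the rule. -/
noncomputable def remainderConstant (n : ℕ) (h : ℝ) : ℝ :=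
  -∫ x in (-h / 2)..(h / 2), x * (nodePoly n h).eval x / ((n + 1).factorial : ℝ)

theorem DerivSeq.exists_error_eq (hn : Odd n) (hh : 0 < h) {F : ℕ → ℝ → ℝ}
    (hF : DerivSeq (n + 1) F (hull n h)) :
    ∃ ξ ∈ hull n h, error n h (F 0) = F (n + 1) ξ * remainderConstant n h := by
  obtain ⟨H, hdeg, hH, hH', hrule⟩ := exists_hermite hn hh (F 0) (F 1 0)
  have hsub := Icc_subset_hull (n := n) hh
  have hab : -h / 2 < h / 2 := by linarith
  have hF0 : ContinuousOn (F 0) (Icc (-h / 2) (h / 2)) := fun x hx =>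
    (hF 0 n.succ_pos x (hsub hx)).continuousWithinAt.mono hsub
  have hD : (F (n + 1) '' hull n h).OrdConnected :=
    ordConnected_Icc.image_hasDerivWithinAt (hF n n.lt_succ_self)
  have hfac : (0 : ℝ) < (n + 1).factorial := by positivity
  have hsign : ∀ x : ℝ, x * (nodePoly n h).eval x / ((n + 1).factorial : ℝ) * nodeSign n h =
      x ^ 2 * (∏ k ∈ (indices n).erase 0, ((x - k * h) * (0 - (k : ℝ) * h))) /
        (n + 1).factorial := fun x => by
    rw [← mul_nodeSign]; ring
  obtain ⟨d, ⟨ξ, hξ, rfl⟩, hd⟩ := exists_integral_eq_mul hab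
    (g := fun x => F 0 x - H.eval x)
    (w := fun x => x * (nodePoly n h).eval x / ((n + 1).factorial : ℝ)) (σ := nodeSign n h)
    (hF0.sub H.continuous.continuousOn)
    (((continuous_id.mul (nodePoly n h).continuous).div_const _).continuousOn)
    (fun x hx => by
      simp only [hsign]
      have := prod_nodes_pos (n := n) hh hx
      positivity)
    ⟨h / 2, right_mem_Icc.2 hab.le, by
      simp only [hsign]
      have := prod_nodes_pos (n := n) hh (right_mem_Icc.2 hab.le)
      positivity⟩
    hD
    (fun x hx => by
      have hc := card_indices hn
      obtain ⟨ξ, hξ, e⟩ := hermite_remainder (s := indices n) (v := fun k : ℤ => (k : ℝ) * h)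
        (node_injective hh).injOn (fun k hk => node_mem_hull hh hk) (zero_mem_indices n)
        (by rw [hc]; exact hF) (by rw [hc]; exact hdeg) hH (by simpa using hH') (hsub hx)
      rw [hc] at e
      exact ⟨_, mem_image_of_mem _ hξ, by simpa [nodePoly] using e⟩)
  refine ⟨ξ, hξ, ?_⟩
  rw [intervalIntegral.integral_sub (hF0.intervalIntegrable_of_Icc hab.le)
    (H.continuous.intervalIntegrable _ _)] at hd
  rw [error, hrule, remainderConstant]
  linarith

theorem monomialError_eq (hn : Odd n) (hh : 0 < h) :
    monomialError n h = remainderConstant n h := by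
  set p : ℝ[X] := C (((n + 1).factorial : ℝ)⁻¹) * X ^ (n + 1) with hp
  obtain ⟨ξ, -, e⟩ := (derivSeq_polynomial (n + 1) p (hull n h)).exists_error_eq hn hh
  have hfac : ((n + 1).factorial : ℝ) ≠ 0 := by positivity
  rw [iterate_derivative_eq_C (natDegree_C_mul_X_pow_le _ _), hp, coeff_C_mul, coeff_X_pow_self,
    eval_C, mul_one, mul_inv_cancel₀ hfac, one_mul] at e
  rw [← e, monomialError]
  congr 1
  ext x
  simp [div_eq_inv_mul]

/-- Both the rule and the integral are homogeneous of degree `n + 2` in `h` on `x ^ (n + 1)`. -/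
theorem normalizedError_eq (hh : 0 < h) : normalizedError n h = monomialError n 1 := by
  rw [normalizedError, div_eq_iff (by positivity)]
  simp only [monomialError, error, simpleRule, intervalIntegral.integral_div, integral_pow]
  rw [sub_mul, Finset.mul_sum, Finset.mul_sum, Finset.sum_mul]
  congr 1
  · refine Finset.sum_congr rfl fun k _ => ?_
    ring
  · simp only [div_eq_mul_inv, neg_mul]
    rw [show -(h * 2⁻¹) = h * (-(1 * 2⁻¹)) by ring, mul_pow, mul_pow, mul_pow]
    ring

theorem hasOrder (hn : Odd n) : HasOrder n n := by
  intro h hh p hp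
  obtain ⟨ξ, -, e⟩ := (derivSeq_polynomial (n + 1) p (hull n h)).exists_error_eq hn hh
  rw [iterate_derivative_eq_zero (Nat.lt_succ_of_le hp), eval_zero, zero_mul] at e
  exact e

end CenteredRule

theorem mainTheorem2 (n : ℕ) (hn : Odd n) :
    (∃ Rhat : ℝ,
      (∀ h : ℝ, 0 < h → CenteredRule.normalizedError n h = Rhat) ∧
      ∀ h : ℝ, 0 < h → ∀ f : ℝ → ℝ,
        CenteredRule.TimesDifferentiableOn (n + 1) f (CenteredRule.hull n h) →
        ∃ ξ ∈ CenteredRule.hull n h,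
          CenteredRule.error n h f =
            iteratedDerivWithin (n + 1) f (CenteredRule.hull n h) ξ *
              CenteredRule.monomialError n h ∧
          CenteredRule.error n h f =
            Rhat * h ^ (n + 2) * iteratedDerivWithin (n + 1) f (CenteredRule.hull n h) ξ) ∧
    CenteredRule.HasOrder n n := by
  refine ⟨⟨CenteredRule.monomialError n 1, fun h hh => CenteredRule.normalizedError_eq hh,
    fun h hh f hf => ?_⟩, CenteredRule.hasOrder hn⟩
  obtain ⟨ξ, hξ, e⟩ := hf.derivSeq.exists_error_eq hn hh
  rw [iteratedDerivWithin_zero, ← CenteredRule.monomialError_eq hn hh] at e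
  refine ⟨ξ, hξ, e, ?_⟩
  have hpow : h ^ (n + 2) ≠ 0 := by positivity
  rw [e, ← CenteredRule.normalizedError_eq hh, CenteredRule.normalizedError,
    div_mul_cancel₀ _ hpow, mul_comm]
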